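/- Let $(\Omega,m)$ be a measure space such that the Banach space $L^1=L^1(m)$ of (real or complex) integrable functions is separable. Let $\tau_m$ be the topology of local convergence in measure on $L^1$, i.e. the topology of convergence in measure on every measurable set of finite measure. Let $X$ be a closed linear subspace of $L^1$, with closed unit ball $B_X=\{f\in X:\|f\|_1\le 1\}$, and let $X^\sharp$ be the space of all $x^*\in X^*$ whose restriction to $B_X$ is $\tau_m$-continuous, equipped with the norm of $X^*$. Let $(T_n)_{n\ge 1}$ be a sequence of bounded linear operators from $L^1$ to itself such that $\lim_n\|T_n(f)-f\|_1=0$ for every $f\in L^1$. Assume that (1) for every $n$, $T_n(X)\subset X$ and the restriction of $T_n$ to $X$ is a weakly compact operator from $X$ to $X$; (2) for every $n$ and every $\|\cdot\|_1$-bounded subset $S$ of $L^1$, the restriction of $T_n$ to $S$ is $\tau_m$–$\tau_m$ continuous. Then $X$ is nicely placed, that is, $B_X$ is $\tau_m$-closed in $L^1$, and $X$ is isometric to the dual $(X^\sharp)^*$ of $X^\sharp$: the canonical map $X\to (X^\sharp)^*$, $f\mapsto (x^*\mapsto x^*(f))$, is an isometric linear bijection. -/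

import Mathlib

set_option maxSynthPendingDepth 3

open MeasureTheory Filter Topology
open scoped ENNReal

/-- The basic neighbourhood of `f` in the topology of local convergence in measure attached to a
set `A` and a number `ε`: all `g` in `L¹(μ)` with `μ {x ∈ A : |g x - f x| ≥ ε} < ε`. -/
def localMeasureBall {α : Type*} [MeasurableSpace α] {𝕜 : Type*} [RCLike 𝕜] {μ : Measure α}
    (f : Lp 𝕜 1 μ) (A : Set α) (ε : ℝ) : Set (Lp 𝕜 1 μ) :=
  {g | μ {x | x ∈ A ∧ ε ≤ ‖g x - f x‖} < ENNReal.ofReal ε}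

/-- Enlarging the set and shrinking the number shrinks the basic neighbourhood. -/
theorem localMeasureBall_subset {α : Type*} [MeasurableSpace α] {𝕜 : Type*} [RCLike 𝕜]
    {μ : Measure α} (f : Lp 𝕜 1 μ) {A B : Set α} {ε δ : ℝ} (hAB : A ⊆ B) (h : δ ≤ ε) :
    localMeasureBall f B δ ⊆ localMeasureBall f A ε := fun _ hg =>
  lt_of_le_of_lt (measure_mono fun _ (hx : _ ∧ _) => And.intro (hAB hx.1) (h.trans hx.2))
    (lt_of_lt_of_le hg (ENNReal.ofReal_le_ofReal h))

/-- The topology `τ_μ` of local convergence in measure (that is, of convergence in measure on every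
measurable set of finite measure) on the space `L¹(μ)` of scalar functions. -/
@[reducible] def localMeasureTopology {α : Type*} [MeasurableSpace α] (𝕜 : Type*) [RCLike 𝕜]
    (μ : Measure α) : TopologicalSpace (Lp 𝕜 1 μ) where
  IsOpen U := ∀ f ∈ U, ∃ A : Set α, MeasurableSet A ∧ μ A < ∞ ∧
    ∃ ε : ℝ, 0 < ε ∧ localMeasureBall f A ε ⊆ U
  isOpen_univ := fun _ _ => ⟨∅, MeasurableSet.empty, by simp, 1, one_pos, Set.subset_univ _⟩
  isOpen_inter := by
    rintro U V hU hV f ⟨hfU, hfV⟩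
    obtain ⟨A, hA, hA', ε, hε, h⟩ := hU f hfU
    obtain ⟨B, hB, hB', δ, hδ, h'⟩ := hV f hfV
    exact ⟨A ∪ B, hA.union hB, measure_union_lt_top hA' hB', min ε δ, lt_min hε hδ,
      Set.subset_inter
        ((localMeasureBall_subset f Set.subset_union_left (min_le_left _ _)).trans h)
        ((localMeasureBall_subset f Set.subset_union_right (min_le_right _ _)).trans h')⟩
  isOpen_sUnion := by
    rintro S hS f ⟨U, hU, hf⟩
    obtain ⟨A, hA, hA', ε, hε, h⟩ := hS U hU f hf
    exact ⟨A, hA, hA', ε, hε, h.trans (Set.subset_sUnion_of_mem hU)⟩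

/-- The basic neighbourhoods are a neighbourhood basis for `localMeasureTopology`. -/
theorem mem_nhds_localMeasureTopology {α : Type*} [MeasurableSpace α] {𝕜 : Type*} [RCLike 𝕜]
    {μ : Measure α} (f : Lp 𝕜 1 μ) (U : Set (Lp 𝕜 1 μ)) :
    U ∈ @nhds _ (localMeasureTopology 𝕜 μ) f ↔ ∃ A : Set α, MeasurableSet A ∧ μ A < ∞ ∧
      ∃ ε : ℝ, 0 < ε ∧ localMeasureBall f A ε ⊆ U := by
  have self : ∀ (g : Lp 𝕜 1 μ) (A : Set α) (ε : ℝ), 0 < ε → g ∈ localMeasureBall g A ε := by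
    intro g A ε hε
    have h0 : {x | x ∈ A ∧ ε ≤ ‖g x - g x‖} = ∅ := by
      ext x; simp [hε]
    change μ {x | x ∈ A ∧ ε ≤ ‖g x - g x‖} < ENNReal.ofReal ε
    rw [h0, measure_empty]
    exact ENNReal.ofReal_pos.2 hε
  refine Iff.trans (@mem_nhds_iff _ (localMeasureTopology 𝕜 μ) f U) ?_
  constructor
  · rintro ⟨V, hVU, hV, hf⟩
    obtain ⟨A, hA, hA', ε, hε, h⟩ := hV f hf
    exact ⟨A, hA, hA', ε, hε, h.trans hVU⟩
  · rintro hf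
    refine ⟨{g | ∃ A : Set α, MeasurableSet A ∧ μ A < ∞ ∧
      ∃ ε : ℝ, 0 < ε ∧ localMeasureBall g A ε ⊆ U}, ?_, ?_, hf⟩
    · rintro g ⟨A, -, -, ε, hε, h⟩
      exact h (self g A ε hε)
    · rintro g ⟨A, hA, hA', ε, hε, h⟩
      refine ⟨A, hA, hA', ε / 2, half_pos hε, fun k hk =>
        ⟨A, hA, hA', ε / 2, half_pos hε, fun l hl => h ?_⟩⟩
      refine lt_of_le_of_lt (measure_mono (t := {x | x ∈ A ∧ ε / 2 ≤ ‖l x - k x‖} ∪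
        {x | x ∈ A ∧ ε / 2 ≤ ‖k x - g x‖}) ?_) ?_
      · rintro x ⟨hxA, hx⟩
        by_contra hcon
        simp only [Set.mem_union, Set.mem_ofPred_eq, hxA, true_and, not_or, not_le] at hcon
        have := norm_sub_le_norm_sub_add_norm_sub (l x) (k x) (g x)
        linarith [hcon.1, hcon.2]
      · calc _ ≤ _ := measure_union_le _ _
          _ < ENNReal.ofReal (ε / 2) + ENNReal.ofReal (ε / 2) := ENNReal.add_lt_add hl hk
          _ = ENNReal.ofReal ε := by
            rw [← ENNReal.ofReal_add (half_pos hε).le (half_pos hε).le, add_halves]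

/-- Convergence in `localMeasureTopology` is convergence in measure on every measurable set of
finite measure. -/
theorem tendsto_localMeasureTopology_iff {α : Type*} [MeasurableSpace α] {𝕜 : Type*} [RCLike 𝕜]
    {μ : Measure α} {ι : Type*} {l : Filter ι} (u : ι → Lp 𝕜 1 μ) (f : Lp 𝕜 1 μ) :
    Tendsto u l (@nhds _ (localMeasureTopology 𝕜 μ) f) ↔
      ∀ A : Set α, MeasurableSet A → μ A < ∞ →
        TendstoInMeasure (μ.restrict A) (fun i => (u i : α → 𝕜)) l f := by
  have key : ∀ (A : Set α) (i : ι) (ε : ℝ), MeasurableSet A →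
      μ.restrict A {x | ε ≤ ‖u i x - f x‖} = μ {x | x ∈ A ∧ ε ≤ ‖u i x - f x‖} := by
    intro A i ε hA
    rw [Measure.restrict_apply' hA, Set.inter_comm]
    rfl
  simp only [tendstoInMeasure_iff_norm]
  constructor
  · intro h A hA hA' ε hε
    rw [ENNReal.tendsto_nhds_zero]
    intro δ hδ
    obtain ⟨r, hr, hrδ⟩ := ENNReal.lt_iff_exists_real_btwn.1 hδ
    have hr0 : 0 < r := ENNReal.ofReal_pos.1 hrδ.1
    filter_upwards [h ((mem_nhds_localMeasureTopology f _).2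
      ⟨A, hA, hA', min ε r, lt_min hε hr0, Set.Subset.rfl⟩)] with i hi
    rw [key A i ε hA]
    refine (measure_mono ?_).trans (hi.le.trans
      ((ENNReal.ofReal_le_ofReal (min_le_right _ _)).trans hrδ.2.le))
    exact fun x hx => ⟨hx.1, (min_le_left _ _).trans hx.2⟩
  · intro h U hU
    obtain ⟨A, hA, hA', ε, hε, hU⟩ := (mem_nhds_localMeasureTopology f U).1 hU
    have hev := (h A hA hA' ε hε).eventually (gt_mem_nhds (ENNReal.ofReal_pos.2 hε))
    refine hev.mono fun i hi => hU ?_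
    rw [key A i ε hA] at hi
    exact hi

/-- A linear subspace `X` of `L¹(μ)` is nicely placed if its closed unit ball is closed in `L¹(μ)`
for the topology of local convergence in measure. -/
def IsNicelyPlaced {α : Type*} [MeasurableSpace α] {𝕜 : Type*} [RCLike 𝕜] {μ : Measure α}
    (X : Submodule 𝕜 (Lp 𝕜 1 μ)) : Prop :=
  IsClosed[localMeasureTopology 𝕜 μ] {f : Lp 𝕜 1 μ | f ∈ X ∧ ‖f‖ ≤ 1}

/-- The topology of local convergence in measure on a subspace `X` of `L¹(μ)`. -/
@[reducible] def subspaceLocalMeasureTopology {α : Type*} [MeasurableSpace α] {𝕜 : Type*} [RCLike 𝕜]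
    {μ : Measure α} (X : Submodule 𝕜 (Lp 𝕜 1 μ)) : TopologicalSpace X :=
  (localMeasureTopology 𝕜 μ).induced Subtype.val

/-- The space `X^♯` of all bounded linear functionals on `X` whose restriction to the closed unit
ball of `X` is continuous for the topology of local convergence in measure; as a subspace of the
normed dual of `X` it carries the dual norm. -/
def sharpDual {α : Type*} [MeasurableSpace α] {𝕜 : Type*} [RCLike 𝕜] {μ : Measure α}
    (X : Submodule 𝕜 (Lp 𝕜 1 μ)) : Submodule 𝕜 (StrongDual 𝕜 X) where
  carrier := {φ | @ContinuousOn X 𝕜 (subspaceLocalMeasureTopology X) _ (fun f => φ f)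
    (Metric.closedBall (0 : X) 1)}
  add_mem' := fun hφ hψ =>
    @ContinuousOn.add 𝕜 _ _ _ X (subspaceLocalMeasureTopology X) _ _ _ hφ hψ
  zero_mem' := @continuousOn_const X 𝕜 (subspaceLocalMeasureTopology X) _ _ _
  smul_mem' := fun c _ hφ =>
    @ContinuousOn.const_smul 𝕜 𝕜 X _ _ _ (subspaceLocalMeasureTopology X) _ _ hφ c

/-- A bounded linear operator is weakly compact if the image of the closed unit ball is relatively
compact in the weak topology of the target. -/
def IsWeaklyCompactOperator {𝕜 : Type*} [RCLike 𝕜] {E F : Type*}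
    [NormedAddCommGroup E] [NormedSpace 𝕜 E] [NormedAddCommGroup F] [NormedSpace 𝕜 F]
    (T : E →L[𝕜] F) : Prop :=
  IsCompact (closure ((fun x => toWeakSpace 𝕜 F (T x)) '' Metric.closedBall (0 : E) 1))

/-! Bounded convex sets in `L¹` behave as if compact for almost everywhere convergence: a decreasing
directed family of them has a common a.e. limit (`exists_common_ae_limit`), found by nearly
minimising the strictly convex functional `∫ √(w² + |f|²)` with an integrable weight `w`. Helly's
theorem (`exists_closedBall_norm_sub_le`) turns a `Φ` in the unit ball of `(X^♯)*` into such a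
family, the approximate solutions in `B_X` of `y(f) = Φ(y)`. If `B_X` is `τ_m`-closed, the limit
lies in `B_X` and, each `y` being `τ_m`-continuous there, it represents `Φ`. So the ball of `X` maps
onto the ball of `(X^♯)*`, and an isometry results once `X^♯` separates points.

The operators `T_n` give both closedness and separation. A weak cluster point of an a.e. convergent
sequence is its a.e. limit (`eq_of_tendsto_ae_of_mapClusterPt`), so `T_n` carries the `τ_m`-closure
of `S ⊆ B_X` into the weak closure of `T_n(S)` (`exists_apply_mem_weak_closure`). Hence `T_n f ∈ X`
for `f` in the `τ_m`-closure of `B_X`, and `y ∘ T_n ∈ X^♯` for all `y ∈ X*`; then `T_n f → f`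
concludes. -/

/-! ### Pointwise strict convexity of `√(w² + |a|²)`. -/

/-- A quantitative form of the strict convexity of the Euclidean norm on vectors with a common
coordinate `w`: `A`, `B`, `M` are the norms of two such vectors and of their midpoint. -/
theorem sq_mul_sq_le_of_parallelogram {w A B M d s p q : ℝ} (hA0 : 0 ≤ A) (hB0 : 0 ≤ B)
    (hA : A ^ 2 = w ^ 2 + p ^ 2) (hB : B ^ 2 = w ^ 2 + q ^ 2)
    (hM : M ^ 2 = w ^ 2 + s ^ 2 / 4) (hpar : s ^ 2 + d ^ 2 = 2 * (p ^ 2 + q ^ 2))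
    (h1 : d ^ 2 ≤ (p + q) ^ 2) (h2 : (p - q) ^ 2 ≤ d ^ 2) :
    w ^ 2 * d ^ 2 ≤ (A + B) ^ 3 * (A + B - 2 * M) ∧ 2 * M ≤ A + B := by
  -- By polarization `r` is the real inner product of the two varying parts, and `h1`, `h2` say `|r|
  -- ≤ pq`. Then `w ^ 2 + r` is the inner product of the full vectors; the Cauchy–Schwarz defect `A
  -- * B - (w ^ 2 + r)` is bounded below through `w * d` and above through `A + B - 2 * M`.
  obtain ⟨r, hr⟩ : ∃ r, 2 * r = p ^ 2 + q ^ 2 - d ^ 2 := ⟨(p ^ 2 + q ^ 2 - d ^ 2) / 2, by ring⟩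
  have hr1 : r ≤ p * q := by linarith [show (p - q) ^ 2 = p ^ 2 + q ^ 2 - 2 * (p * q) by ring]
  have hr2 : -(p * q) ≤ r := by
    linarith [show (p + q) ^ 2 = p ^ 2 + q ^ 2 + 2 * (p * q) by ring]
  have hr3 : r ^ 2 ≤ (p * q) ^ 2 := sq_le_sq' hr2 hr1
  have hAB : (A * B) ^ 2 - (w ^ 2 + r) ^ 2 = w ^ 2 * d ^ 2 + ((p * q) ^ 2 - r ^ 2) := by
    rw [mul_pow, hA, hB, show d ^ 2 = p ^ 2 + q ^ 2 - 2 * r by linarith]; ring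
  have hAB0 : 0 ≤ A * B := mul_nonneg hA0 hB0
  have hwd : 0 ≤ w ^ 2 * d ^ 2 := by positivity
  have hle : w ^ 2 + r ≤ A * B := by
    refine le_of_sq_le_sq ?_ hAB0
    linarith
  have hN : (A + B) ^ 2 - (2 * M) ^ 2 = 2 * (A * B - (w ^ 2 + r)) := by
    linarith [show (A + B) ^ 2 - (2 * M) ^ 2 = A ^ 2 + B ^ 2 + 2 * (A * B) - 4 * M ^ 2 by ring]
  have hmid : 2 * M ≤ A + B := by
    refine le_of_sq_le_sq ?_ (by positivity)
    linarith
  refine ⟨?_, hmid⟩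
  have e1 : w ^ 2 * d ^ 2 ≤ (A * B - (w ^ 2 + r)) * (2 * (A * B)) := by
    have : w ^ 2 * d ^ 2 ≤ (A * B - (w ^ 2 + r)) * (A * B + (w ^ 2 + r)) := by
      linarith [show (A * B - (w ^ 2 + r)) * (A * B + (w ^ 2 + r)) =
        (A * B) ^ 2 - (w ^ 2 + r) ^ 2 by ring]
    exact this.trans (mul_le_mul_of_nonneg_left (by linarith) (by linarith))
  have e2 : 2 * (A * B - (w ^ 2 + r)) ≤ (A + B - 2 * M) * (2 * (A + B)) := by
    rw [← hN, sq_sub_sq, mul_comm]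
    exact mul_le_mul_of_nonneg_left (by linarith) (by linarith)
  have e3 : A * B ≤ (A + B) ^ 2 / 2 := by nlinarith [sq_nonneg A, sq_nonneg B]
  calc w ^ 2 * d ^ 2 ≤ (2 * (A * B - (w ^ 2 + r))) * (A * B) := by linarith
    _ ≤ ((A + B - 2 * M) * (2 * (A + B))) * ((A + B) ^ 2 / 2) :=
      mul_le_mul e2 e3 hAB0 (mul_nonneg (by linarith) (by positivity))
    _ = _ := by ring

theorem norm_sub_sq_weight_le {𝕜 : Type*} [RCLike 𝕜] (w : ℝ) (a b : 𝕜) :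
    w ^ 2 * ‖a - b‖ ^ 2 ≤ (√(w ^ 2 + ‖a‖ ^ 2) + √(w ^ 2 + ‖b‖ ^ 2)) ^ 3 *
      (√(w ^ 2 + ‖a‖ ^ 2) + √(w ^ 2 + ‖b‖ ^ 2) - 2 * √(w ^ 2 + ‖(2⁻¹ : 𝕜) * (a + b)‖ ^ 2)) ∧
    2 * √(w ^ 2 + ‖(2⁻¹ : 𝕜) * (a + b)‖ ^ 2) ≤ √(w ^ 2 + ‖a‖ ^ 2) + √(w ^ 2 + ‖b‖ ^ 2) := by
  have hpar : ‖a + b‖ ^ 2 + ‖a - b‖ ^ 2 = 2 * (‖a‖ ^ 2 + ‖b‖ ^ 2) := by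
    linarith [parallelogram_law_with_norm 𝕜 a b, sq ‖a + b‖, sq ‖a - b‖, sq ‖a‖, sq ‖b‖]
  have hhalf : ‖(2⁻¹ : 𝕜) * (a + b)‖ ^ 2 = ‖a + b‖ ^ 2 / 4 := by
    rw [norm_mul, norm_inv, RCLike.norm_ofNat]; ring
  refine sq_mul_sq_le_of_parallelogram (Real.sqrt_nonneg _) (Real.sqrt_nonneg _)
    (Real.sq_sqrt (by positivity)) (Real.sq_sqrt (by positivity)) ?_ hpar
    (pow_le_pow_left₀ (norm_nonneg _) (norm_sub_le a b) 2)
    (sq_le_sq.2 ((abs_norm_sub_norm_le a b).trans (le_abs_self _)))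
  rw [← hhalf]
  exact Real.sq_sqrt (by positivity)

/-- With `u = tN` and `v = t⁻³D`, the preceding bound reads `(w|a - b|)² ≤ N³D = u³v ≤ (u + v)⁴`.
Taking fourth roots makes it linear in `N` and in the convexity defect `D`, hence integrable; `t`
remains free to balance the two terms. -/
theorem sqrt_weight_mul_norm_sub_le {𝕜 : Type*} [RCLike 𝕜] (w : ℝ) (a b : 𝕜)
    {t : ℝ} (ht : 0 < t) :
    √(w * ‖a - b‖) ≤ t * (√(w ^ 2 + ‖a‖ ^ 2) + √(w ^ 2 + ‖b‖ ^ 2)) +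
      (t ^ 3)⁻¹ * (√(w ^ 2 + ‖a‖ ^ 2) + √(w ^ 2 + ‖b‖ ^ 2) -
        2 * √(w ^ 2 + ‖(2⁻¹ : 𝕜) * (a + b)‖ ^ 2)) := by
  obtain ⟨h, hD⟩ := norm_sub_sq_weight_le w a b
  have hN : 0 ≤ √(w ^ 2 + ‖a‖ ^ 2) + √(w ^ 2 + ‖b‖ ^ 2) := by positivity
  generalize √(w ^ 2 + ‖a‖ ^ 2) + √(w ^ 2 + ‖b‖ ^ 2) = N at *
  rw [← sub_nonneg] at hD
  generalize N - 2 * √(w ^ 2 + ‖(2⁻¹ : 𝕜) * (a + b)‖ ^ 2) = D at *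
  have hu : 0 ≤ t * N := by positivity
  have hv : 0 ≤ (t ^ 3)⁻¹ * D := by positivity
  have huv : N ^ 3 * D = (t * N) ^ 3 * ((t ^ 3)⁻¹ * D) := by field_simp
  rw [huv] at h
  generalize t * N = u at *
  generalize (t ^ 3)⁻¹ * D = v at *
  rw [Real.sqrt_le_left (by positivity)]
  refine le_of_sq_le_sq ?_ (by positivity)
  have e : u ^ 3 * v ≤ ((u + v) ^ 2) ^ 2 := by
    have h1 : 0 ≤ u ^ 4 := by positivity
    have h2 : 0 ≤ u ^ 3 * v := by positivity
    have h3 : 0 ≤ u ^ 2 * v ^ 2 := by positivity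
    have h4 : 0 ≤ u * v ^ 3 := by positivity
    have h5 : 0 ≤ v ^ 4 := by positivity
    nlinarith
  rw [mul_pow]
  exact h.trans e

/-! ### The integrable weight, and a.e. convergent sequences. -/

/-- If `L¹(μ)` is separable, some integrable weight is positive wherever an integrable function
does not vanish. -/
theorem exists_integrable_weight {α : Type*} [MeasurableSpace α] (𝕜 : Type*) [RCLike 𝕜]
    (μ : Measure α) [TopologicalSpace.SeparableSpace (Lp 𝕜 1 μ)] :
    ∃ w : α → ℝ, Measurable w ∧ (∀ x, 0 ≤ w x) ∧ Integrable w μ ∧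
      ∀ f : Lp 𝕜 1 μ, ∀ᵐ x ∂μ, w x = 0 → f x = 0 := by
  set d : ℕ → Lp 𝕜 1 μ := TopologicalSpace.denseSeq (Lp 𝕜 1 μ)
  have hd : ∀ k, ∫⁻ x, ‖d k x‖ₑ ∂μ ≠ ∞ := fun k => (L1.integrable_coeFn (d k)).2.ne
  obtain ⟨c, hc, hsum⟩ := ENNReal.exists_pos_tsum_mul_lt_of_countable one_ne_zero _ hd
  have hdm : ∀ k, Measurable fun x => ‖d k x‖ₑ * (c k : ℝ≥0∞) := fun k =>
    (Lp.stronglyMeasurable (d k)).enorm.mul_const _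
  -- Where this sum vanishes, so does every member of a dense sequence, hence by density every
  -- integrable function.
  set W : α → ℝ≥0∞ := fun x => ∑' k, ‖d k x‖ₑ * (c k : ℝ≥0∞)
  have hWm : Measurable W := Measurable.tsum hdm
  have hW : ∫⁻ x, W x ∂μ ≠ ∞ := by
    rw [lintegral_tsum fun k => (hdm k).aemeasurable]
    refine ((lt_of_eq_of_lt ?_ hsum).trans_le le_top).ne
    exact tsum_congr fun k => lintegral_mul_const _ (Lp.stronglyMeasurable (d k)).enorm
  refine ⟨fun x => (W x).toReal, hWm.ennreal_toReal, fun x => ENNReal.toReal_nonneg,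
    integrable_toReal_of_lintegral_ne_top hWm.aemeasurable hW, fun f => ?_⟩
  set s : Set α := {x | W x = 0}
  have hs : MeasurableSet s := hWm (measurableSet_singleton 0)
  have hzero : ∀ f : Lp 𝕜 1 μ, LpToLpRestrictCLM α 𝕜 𝕜 μ 1 s f = 0 := by
    refine fun f => congrFun (Continuous.ext_on (TopologicalSpace.denseRange_denseSeq _)
      (LpToLpRestrictCLM α 𝕜 𝕜 μ 1 s).continuous continuous_const ?_) f
    rintro _ ⟨k, rfl⟩
    refine Lp.ext ((LpToLpRestrictCLM_coeFn 𝕜 s (d k)).trans ?_)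
    refine EventuallyEq.trans ?_ (Lp.coeFn_zero _ _ _).symm
    filter_upwards [ae_restrict_mem hs] with x hx
    have := ENNReal.tsum_eq_zero.1 hx k
    simpa [(hc k).ne'] using this
  have h0 : f =ᵐ[μ.restrict s] 0 := by
    refine (LpToLpRestrictCLM_coeFn 𝕜 s f).symm.trans ?_
    rw [hzero f]
    exact Lp.coeFn_zero _ _ _
  filter_upwards [(ae_restrict_iff' hs).1 h0, ae_lt_top hWm hW] with x hx hx' hx0
  exact hx (((ENNReal.toReal_eq_zero_iff _).1 hx0).resolve_right hx'.ne)

/-- A point of the closure for local convergence in measure is an almost everywhere limit of a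
sequence. -/
theorem exists_seq_tendsto_ae_of_mem_closure {α : Type*} [MeasurableSpace α] {𝕜 : Type*}
    [RCLike 𝕜] {μ : Measure α} [TopologicalSpace.SeparableSpace (Lp 𝕜 1 μ)]
    {S : Set (Lp 𝕜 1 μ)} {f : Lp 𝕜 1 μ} (hf : f ∈ @closure _ (localMeasureTopology 𝕜 μ) S) :
    ∃ u : ℕ → Lp 𝕜 1 μ, (∀ k, u k ∈ S) ∧
      ∀ᵐ x ∂μ, Tendsto (fun k => u k x) atTop (𝓝 (f x)) := by
  obtain ⟨w, hwm, hw0, hwi, hw⟩ := exists_integrable_weight 𝕜 μ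
  -- These sets have finite measure and exhaust `{w > 0}`. With radii `2⁻ʲ`, Borel–Cantelli gives
  -- a.e. convergence there; elsewhere all functions vanish.
  set A : ℕ → Set α := fun j => {x | ((j : ℝ) + 1)⁻¹ ≤ w x}
  have hA : ∀ j, MeasurableSet (A j) := fun j => measurableSet_le measurable_const hwm
  have hA' : ∀ j, μ (A j) < ∞ := fun j => hwi.measure_ge_lt_top (by positivity)
  have hex : ∀ j : ℕ, ∃ g ∈ S, g ∈ localMeasureBall f (A j) ((1 / 2 : ℝ) ^ j) := by
    intro j
    have := (@mem_closure_iff_nhds _ (localMeasureTopology 𝕜 μ) f S).1 hf _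
      ((mem_nhds_localMeasureTopology f _).2 ⟨A j, hA j, hA' j, (1 / 2 : ℝ) ^ j, by positivity,
        Set.Subset.rfl⟩)
    obtain ⟨g, hg, hgS⟩ := this
    exact ⟨g, hgS, hg⟩
  choose u huS hu using hex
  refine ⟨u, huS, ?_⟩
  have hsum : ∑' j, μ {x | x ∈ A j ∧ (1 / 2 : ℝ) ^ j ≤ ‖u j x - f x‖} ≠ ∞ := by
    refine ne_top_of_le_ne_top ?_ (ENNReal.tsum_le_tsum fun j => (hu j).le)
    rw [← ENNReal.ofReal_tsum_of_nonneg (fun j => by positivity) summable_geometric_two]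
    exact ENNReal.ofReal_ne_top
  have hu0 : ∀ᵐ x ∂μ, ∀ j, w x = 0 → u j x = 0 := ae_all_iff.2 fun j => hw (u j)
  filter_upwards [ae_eventually_notMem hsum, hu0, hw f] with x hx hx0 hxf
  rcases (hw0 x).eq_or_lt with h | h
  · simp [hx0 _ h.symm, hxf h.symm]
  · have hxA : ∀ᶠ j : ℕ in atTop, x ∈ A j := by
      have : Tendsto (fun j : ℕ => ((j : ℝ) + 1)⁻¹) atTop (𝓝 0) := by
        simpa using tendsto_one_div_add_atTop_nhds_zero_nat (𝕜 := ℝ)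
      filter_upwards [this.eventually (gt_mem_nhds h)] with j hj using le_of_lt hj
    rw [tendsto_iff_norm_sub_tendsto_zero]
    refine squeeze_zero' (Eventually.of_forall fun _ => norm_nonneg _) ?_
      (tendsto_pow_atTop_nhds_zero_of_lt_one (r := (1 / 2 : ℝ)) (by norm_num) (by norm_num))
    filter_upwards [hx, hxA] with j hj hjA
    by_contra hcon
    exact hj ⟨hjA, (not_le.1 hcon).le⟩

theorem tendsto_localMeasureTopology_of_ae {α : Type*} [MeasurableSpace α] {𝕜 : Type*}
    [RCLike 𝕜] {μ : Measure α} {u : ℕ → Lp 𝕜 1 μ} {f : Lp 𝕜 1 μ}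
    (h : ∀ᵐ x ∂μ, Tendsto (fun k => u k x) atTop (𝓝 (f x))) :
    Tendsto u atTop (@nhds _ (localMeasureTopology 𝕜 μ) f) := by
  refine (tendsto_localMeasureTopology_iff u f).2 fun A _ hA => ?_
  have : IsFiniteMeasure (μ.restrict A) := ⟨by simpa using hA⟩
  exact tendstoInMeasure_of_tendsto_ae
    (fun k => (Lp.stronglyMeasurable (u k)).aestronglyMeasurable) (ae_restrict_of_ae h)

/-! ### The strictly convex functional and common a.e. limits. -/

theorem integrable_sqrt_sq_add_norm_sq {α : Type*} [MeasurableSpace α] {𝕜 : Type*} [RCLike 𝕜]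
    {μ : Measure α} {w : α → ℝ} (hw0 : ∀ x, 0 ≤ w x) (hw : Integrable w μ) (f : Lp 𝕜 1 μ) :
    Integrable (fun x => √(w x ^ 2 + ‖f x‖ ^ 2)) μ := by
  have hf := L1.integrable_coeFn f
  refine (hw.add hf.norm).mono' ?_ (Eventually.of_forall fun x => ?_)
  · exact Real.continuous_sqrt.comp_aestronglyMeasurable
      ((hw.1.pow 2).add (hf.1.norm.pow 2))
  · rw [Real.norm_of_nonneg (Real.sqrt_nonneg _)]
    refine Real.sqrt_le_iff.2 ⟨add_nonneg (hw0 x) (norm_nonneg _), ?_⟩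
    simp only [Pi.add_apply]
    nlinarith [mul_nonneg (hw0 x) (norm_nonneg (f x))]

theorem integral_sqrt_sq_add_norm_sq_le {α : Type*} [MeasurableSpace α] {𝕜 : Type*} [RCLike 𝕜]
    {μ : Measure α} {w : α → ℝ} (hw0 : ∀ x, 0 ≤ w x) (hw : Integrable w μ) (f : Lp 𝕜 1 μ) :
    ∫ x, √(w x ^ 2 + ‖f x‖ ^ 2) ∂μ ≤ ∫ x, w x ∂μ + ‖f‖ := by
  have hf := L1.integrable_coeFn f
  rw [L1.norm_eq_integral_norm, ← integral_add hw hf.norm]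
  refine integral_mono (integrable_sqrt_sq_add_norm_sq hw0 hw f) (hw.add hf.norm) fun x => ?_
  refine Real.sqrt_le_iff.2 ⟨add_nonneg (hw0 x) (norm_nonneg _), ?_⟩
  nlinarith [mul_nonneg (hw0 x) (norm_nonneg (f x))]

/-- The integrated convexity defect is at most `2c - 2(c - δ) = 2δ`. -/
theorem lintegral_sqrt_weight_mul_norm_sub_le {α : Type*} [MeasurableSpace α] {𝕜 : Type*}
    [RCLike 𝕜] {μ : Measure α} {w : α → ℝ} (hw0 : ∀ x, 0 ≤ w x) (hw : Integrable w μ)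
    {f g : Lp 𝕜 1 μ} {c δ t : ℝ} (ht : 0 < t)
    (hf : ∫ x, √(w x ^ 2 + ‖f x‖ ^ 2) ∂μ ≤ c) (hg : ∫ x, √(w x ^ 2 + ‖g x‖ ^ 2) ∂μ ≤ c)
    (hfg : c - δ ≤ ∫ x, √(w x ^ 2 + ‖((2⁻¹ : 𝕜) • (f + g)) x‖ ^ 2) ∂μ) :
    ∫⁻ x, ENNReal.ofReal √(w x * ‖f x - g x‖) ∂μ ≤
      ENNReal.ofReal (t * (2 * c) + (t ^ 3)⁻¹ * (2 * δ)) := by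
  have hfi := integrable_sqrt_sq_add_norm_sq hw0 hw f
  have hgi := integrable_sqrt_sq_add_norm_sq hw0 hw g
  have hmi := integrable_sqrt_sq_add_norm_sq hw0 hw ((2⁻¹ : 𝕜) • (f + g))
  have hN := (hfi.add hgi).const_mul t
  have hD := ((hfi.add hgi).sub (hmi.const_mul 2)).const_mul (t ^ 3)⁻¹
  have hpt : ∀ᵐ x ∂μ, √(w x * ‖f x - g x‖) ≤
      t * (√(w x ^ 2 + ‖f x‖ ^ 2) + √(w x ^ 2 + ‖g x‖ ^ 2)) +
      (t ^ 3)⁻¹ * (√(w x ^ 2 + ‖f x‖ ^ 2) + √(w x ^ 2 + ‖g x‖ ^ 2) -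
        2 * √(w x ^ 2 + ‖((2⁻¹ : 𝕜) • (f + g)) x‖ ^ 2)) := by
    filter_upwards [Lp.coeFn_smul (2⁻¹ : 𝕜) (f + g), Lp.coeFn_add f g] with x h1 h2
    rw [h1, Pi.smul_apply, h2, Pi.add_apply, smul_eq_mul]
    exact sqrt_weight_mul_norm_sub_le (w x) (f x) (g x) ht
  have h0 : ∀ᵐ x ∂μ, (0 : ℝ) ≤ √(w x * ‖f x - g x‖) :=
    Eventually.of_forall fun x => Real.sqrt_nonneg _
  refine (lintegral_mono_ae (hpt.mono fun x hx => ENNReal.ofReal_le_ofReal hx)).trans ?_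
  refine (ofReal_integral_eq_lintegral_ofReal (hN.add hD)
    ((h0.and hpt).mono fun x hx => hx.1.trans hx.2)).symm.trans_le (ENNReal.ofReal_le_ofReal ?_)
  rw [integral_add' hN hD, integral_const_mul, integral_const_mul,
    integral_sub' (hfi.add hgi) (hmi.const_mul 2), integral_const_mul, integral_add' hfi hgi]
  gcongr <;> linarith

/-- Finite integral makes the square roots summable a.e.; their terms are eventually below `1`,
where `s ≤ √s`. -/
theorem ae_summable_norm_sub_of_tsum_sqrt {α : Type*} [MeasurableSpace α] {𝕜 : Type*}
    [RCLike 𝕜] {μ : Measure α} {w : α → ℝ} (hwm : Measurable w) {u v : ℕ → Lp 𝕜 1 μ}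
    (h : ∑' k, ∫⁻ x, ENNReal.ofReal √(w x * ‖u k x - v k x‖) ∂μ ≠ ∞) :
    ∀ᵐ x ∂μ, 0 < w x → Summable fun k => ‖u k x - v k x‖ := by
  have hm : ∀ k, AEMeasurable (fun x => ENNReal.ofReal √(w x * ‖u k x - v k x‖)) μ := fun k =>
    (Real.continuous_sqrt.measurable.comp (hwm.mul ((Lp.stronglyMeasurable (u k)).sub
      (Lp.stronglyMeasurable (v k))).norm.measurable)).ennreal_ofReal.aemeasurable
  rw [← lintegral_tsum hm] at h
  filter_upwards [ae_lt_top' (AEMeasurable.tsum hm) h] with x hx hwx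
  have hs : Summable fun k => √(w x * ‖u k x - v k x‖) := by
    refine (ENNReal.summable_toReal hx.ne).congr fun k => ?_
    exact ENNReal.toReal_ofReal (Real.sqrt_nonneg _)
  have hs' : Summable fun k => w x * ‖u k x - v k x‖ := by
    refine Summable.of_norm_bounded_eventually_nat hs ?_
    filter_upwards [hs.tendsto_atTop_zero.eventually (gt_mem_nhds one_pos)] with k hk
    have h0 : 0 ≤ w x * ‖u k x - v k x‖ := by positivity
    rw [Real.norm_of_nonneg h0]
    nlinarith [Real.sq_sqrt h0, Real.sqrt_nonneg (w x * ‖u k x - v k x‖)]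
  exact (summable_mul_left_iff hwx.ne').1 hs'

/-- Fatou's lemma. -/
theorem eLpNorm_le_of_tendsto_ae {α : Type*} [MeasurableSpace α] {𝕜 : Type*} [RCLike 𝕜]
    {μ : Measure α} {u : ℕ → Lp 𝕜 1 μ} {f : α → 𝕜} {R : ℝ} (hR : ∀ k, ‖u k‖ ≤ R)
    (h : ∀ᵐ x ∂μ, Tendsto (fun k => u k x) atTop (𝓝 (f x))) :
    eLpNorm f 1 μ ≤ ENNReal.ofReal R := by
  refine (Lp.eLpNorm_lim_le_liminf_eLpNorm
    (fun k => (Lp.stronglyMeasurable (u k)).aestronglyMeasurable) f h).trans ?_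
  refine liminf_le_of_frequently_le' (Frequently.of_forall fun k => ?_)
  rw [← ENNReal.ofReal_toReal (Lp.eLpNorm_ne_top (u k)), ← Lp.norm_def]
  exact ENNReal.ofReal_le_ofReal (hR k)

theorem exists_Lp_tendsto_ae {α : Type*} [MeasurableSpace α] {𝕜 : Type*} [RCLike 𝕜]
    {μ : Measure α} {u : ℕ → Lp 𝕜 1 μ} {R : ℝ} (hR : ∀ k, ‖u k‖ ≤ R)
    (h : ∀ᵐ x ∂μ, ∃ l, Tendsto (fun k => u k x) atTop (𝓝 l)) :
    ∃ f : Lp 𝕜 1 μ, ∀ᵐ x ∂μ, Tendsto (fun k => u k x) atTop (𝓝 (f x)) := by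
  obtain ⟨f, hfm, hf⟩ := exists_stronglyMeasurable_limit_of_tendsto_ae
    (fun k => (Lp.stronglyMeasurable (u k)).aestronglyMeasurable) h
  have hmem : MemLp f 1 μ := ⟨hfm.aestronglyMeasurable,
    (eLpNorm_le_of_tendsto_ae hR hf).trans_lt ENNReal.ofReal_lt_top⟩
  refine ⟨hmem.toLp f, ?_⟩
  filter_upwards [hf, hmem.coeFn_toLp] with x hx hx'
  rwa [hx']

/-- A decreasing directed family of nonempty, midpoint convex and uniformly bounded subsets of
`L¹(μ)` has a common almost everywhere limit point. -/
theorem exists_common_ae_limit {α : Type*} [MeasurableSpace α] {𝕜 : Type*} [RCLike 𝕜]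
    {μ : Measure α} [TopologicalSpace.SeparableSpace (Lp 𝕜 1 μ)] {ι : Type*} [SemilatticeSup ι]
    [Nonempty ι] {C : ι → Set (Lp 𝕜 1 μ)} (hanti : Antitone C) (hne : ∀ i, (C i).Nonempty)
    (hmid : ∀ i, ∀ f ∈ C i, ∀ g ∈ C i, (2⁻¹ : 𝕜) • (f + g) ∈ C i) {R : ℝ}
    (hR : ∀ i, ∀ f ∈ C i, ‖f‖ ≤ R) :
    ∃ f : Lp 𝕜 1 μ, ∀ i, ∃ u : ℕ → Lp 𝕜 1 μ, (∀ k, u k ∈ C i) ∧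
      ∀ᵐ x ∂μ, Tendsto (fun k => u k x) atTop (𝓝 (f x)) := by
  obtain ⟨w, hwm, hw0, hwi, hw⟩ := exists_integrable_weight 𝕜 μ
  set φ : Lp 𝕜 1 μ → ℝ := fun f => ∫ x, √(w x ^ 2 + ‖f x‖ ^ 2) ∂μ
  set K : ℝ := ∫ x, w x ∂μ + R
  have hφ0 : ∀ f, 0 ≤ φ f := fun f => integral_nonneg fun x => Real.sqrt_nonneg _
  have hφK : ∀ i, ∀ f ∈ C i, φ f ≤ K := fun i f hf =>
    (integral_sqrt_sq_add_norm_sq_le hw0 hwi f).trans (by simpa [K] using hR i f hf)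
  set m : ι → ℝ := fun i => sInf (φ '' C i)
  have hbdd : ∀ i, BddBelow (φ '' C i) := fun i => ⟨0, by rintro _ ⟨f, -, rfl⟩; exact hφ0 f⟩
  have hm_le : ∀ i, ∀ f ∈ C i, m i ≤ φ f := fun i f hf =>
    csInf_le (hbdd i) (Set.mem_image_of_mem φ hf)
  have hm_mono : Monotone m := fun i j hij =>
    csInf_le_csInf (hbdd i) ((hne j).image φ) (Set.image_mono (hanti hij))
  have hmK : BddAbove (Set.range m) := by
    refine ⟨K, ?_⟩
    rintro _ ⟨i, rfl⟩
    obtain ⟨f, hf⟩ := hne i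
    exact (hm_le i f hf).trans (hφK i f hf)
  set M : ℝ := ⨆ i, m i
  have hmM : ∀ i, m i ≤ M := fun i => le_ciSup hmK i
  have hMK : M ≤ K := ciSup_le fun i => by
    obtain ⟨f, hf⟩ := hne i
    exact (hm_le i f hf).trans (hφK i f hf)
  -- The fourth power beats the factor `t⁻³`: with `t = 2⁻ᵏ`, both terms of the estimate are
  -- `O(2⁻ᵏ)`.
  set η : ℕ → ℝ := fun k => ((1 / 2) ^ k) ^ 4
  have hη : ∀ k, 0 < η k := fun k => by positivity
  have hη1 : ∀ k, η k ≤ 1 := fun k => pow_le_one₀ (by positivity)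
    (pow_le_one₀ (by norm_num) (by norm_num))
  have hηanti : ∀ k, η (k + 1) ≤ η k := fun k =>
    pow_le_pow_left₀ (by positivity)
      (pow_le_pow_of_le_one (by norm_num) (by norm_num) k.le_succ) 4
  have hi : ∀ k, ∃ i, M - η k < m i := fun k => exists_lt_of_lt_ciSup (by linarith [hη k])
  choose i₀ hi₀ using hi
  -- Partial suprema make the indices increase, so that `u (k + 1)` also lies in `C (j k)`.
  set j : ℕ → ι := fun k => partialSups i₀ k
  have hj : ∀ k, M - η k < m (j k) := fun k => (hi₀ k).trans_le (hm_mono (le_partialSups i₀ k))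
  have hex : ∀ i k, ∃ f ∈ C i, φ f < M + η k := by
    intro i k
    obtain ⟨_, ⟨f, hf, rfl⟩, hlt⟩ := exists_lt_of_csInf_lt ((hne i).image φ)
      (show m i < M + η k by linarith [hmM i, hη k])
    exact ⟨f, hf, hlt⟩
  have hclose : ∀ k, ∀ f ∈ C (j k), ∀ g ∈ C (j k), φ f ≤ M + η k → φ g ≤ M + η k →
      ∫⁻ x, ENNReal.ofReal √(w x * ‖f x - g x‖) ∂μ ≤
        ENNReal.ofReal ((2 * (K + 1) + 4) * (1 / 2) ^ k) := by
    intro k f hf g hg hφf hφg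
    -- The midpoint stays in `C (j k)`, where the functional exceeds `M - η k = (M + η k) - 2 * η
    -- k`.
    refine (lintegral_sqrt_weight_mul_norm_sub_le (δ := 2 * η k) (t := (1 / 2) ^ k) hw0 hwi
      (by positivity) hφf hφg ?_).trans (ENNReal.ofReal_le_ofReal ?_)
    · have := hm_le _ _ (hmid _ f hf g hg)
      have := hj k
      linarith
    · have e : (((1 / 2 : ℝ) ^ k) ^ 3)⁻¹ * (2 * (2 * η k)) = 4 * (1 / 2) ^ k := by
        simp only [η]
        have : ((1 / 2 : ℝ) ^ k) ≠ 0 := by positivity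
        generalize (1 / 2 : ℝ) ^ k = t at *
        field_simp
        norm_num
      rw [e]
      have : (1 / 2 : ℝ) ^ k * (2 * (M + η k)) ≤ (1 / 2) ^ k * (2 * (K + 1)) := by
        gcongr
        exact hη1 k
      linarith
  have hfin : ∑' k : ℕ, ENNReal.ofReal ((2 * (K + 1) + 4) * (1 / 2) ^ k) ≠ ∞ := by
    have hK : 0 ≤ K := by
      obtain ⟨i⟩ := ‹Nonempty ι›
      obtain ⟨f, hf⟩ := hne i
      exact (hφ0 f).trans (hφK i f hf)
    rw [← ENNReal.ofReal_tsum_of_nonneg (fun k => by positivity)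
      (summable_geometric_two.mul_left _)]
    exact ENNReal.ofReal_ne_top
  choose u huC huφ using fun k => hex (j k) k
  have hu := ae_summable_norm_sub_of_tsum_sqrt (u := fun k => u (k + 1)) (v := u) hwm
    (ne_top_of_le_ne_top hfin (ENNReal.tsum_le_tsum fun k => hclose k (u (k + 1))
      (hanti ((partialSups i₀).monotone k.le_succ) (huC (k + 1))) (u k) (huC k)
      ((huφ (k + 1)).le.trans (by linarith [hηanti k])) (huφ k).le))
  have hu0 : ∀ᵐ x ∂μ, ∀ k, w x = 0 → u k x = 0 := ae_all_iff.2 fun k => hw (u k)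
  obtain ⟨f, hf⟩ := exists_Lp_tendsto_ae (fun k => hR _ _ (huC k)) (by
    filter_upwards [hu, hu0] with x hx hx0
    rcases (hw0 x).eq_or_lt with h | h
    · exact ⟨0, by simp [hx0 _ h.symm]⟩
    · refine cauchySeq_tendsto_of_complete (cauchySeq_of_summable_dist ?_)
      simpa only [dist_eq_norm, norm_sub_rev] using hx h)
  refine ⟨f, fun i => ?_⟩
  -- Points of `C (j k ⊔ i)` lie in `C i` and are comparable with `u k` inside `C (j k)`, so the
  -- limit does not depend on `i`.
  choose v hvC hvφ using fun k => hex (j k ⊔ i) k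
  refine ⟨v, fun k => hanti le_sup_right (hvC k), ?_⟩
  have hv := ae_summable_norm_sub_of_tsum_sqrt (u := v) (v := u) hwm
    (ne_top_of_le_ne_top hfin (ENNReal.tsum_le_tsum fun k => hclose k (v k)
      (hanti le_sup_left (hvC k)) (u k) (huC k) (hvφ k).le (huφ k).le))
  have hv0 : ∀ᵐ x ∂μ, ∀ k, w x = 0 → v k x = 0 := ae_all_iff.2 fun k => hw (v k)
  filter_upwards [hv, hu0, hv0, hf] with x hx hux hvx hfx
  rcases (hw0 x).eq_or_lt with h | h
  · simpa [hux _ h.symm, hvx _ h.symm] using hfx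
  · simpa using (tendsto_zero_iff_norm_tendsto_zero.2 (hx h).tendsto_atTop_zero).add hfx

/-! ### Helly's theorem. -/

/-- **Helly's theorem** on finitely many conditions: a functional of norm at most one on a space of
functionals is approximated at finitely many of them by evaluation at a point of the unit ball. -/
theorem exists_closedBall_norm_sub_le {𝕜 : Type*} [RCLike 𝕜] {V : Type*} [NormedAddCommGroup V]
    [NormedSpace 𝕜 V] (Y : Submodule 𝕜 (StrongDual 𝕜 V)) (Φ : StrongDual 𝕜 Y) (hΦ : ‖Φ‖ ≤ 1)
    (E : Finset Y) {ε : ℝ} (hε : 0 < ε) :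
    ∃ f : V, ‖f‖ ≤ 1 ∧ ∀ y ∈ E, ‖(y : StrongDual 𝕜 V) f - Φ y‖ ≤ ε := by
  classical
  let _ : NormedSpace ℝ V := NormedSpace.restrictScalars ℝ 𝕜 V
  let L : V →ₗ[𝕜] (E → 𝕜) := LinearMap.pi fun y => ((y : Y) : StrongDual 𝕜 V).toLinearMap
  set p : E → 𝕜 := fun y => Φ y
  have hconv : Convex ℝ (L '' Metric.closedBall 0 1) :=
    (convex_closedBall (0 : V) 1).is_linear_image
      ⟨L.map_add, fun c f => by rw [RCLike.real_smul_eq_coe_smul (K := 𝕜), L.map_smul,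
        RCLike.real_smul_eq_coe_smul (K := 𝕜)]⟩
  by_cases hp : p ∈ closure (L '' Metric.closedBall 0 1)
  · obtain ⟨_, ⟨f, hf, rfl⟩, hlt⟩ := Metric.mem_closure_iff.1 hp ε hε
    refine ⟨f, by simpa using hf, fun y hy => ?_⟩
    have := (dist_le_pi_dist p (L f) ⟨y, hy⟩).trans hlt.le
    rwa [dist_comm, dist_eq_norm] at this
  · exfalso
    obtain ⟨l, c, hlc, hcp⟩ := RCLike.geometric_hahn_banach_closed_point (𝕜 := 𝕜)
      hconv.closure isClosed_closure hp
    have hl : ∀ z : E → 𝕜, l z = ∑ y, z y * l (Pi.single y 1) := fun z => by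
      conv_lhs => rw [← Finset.univ_sum_single z]
      rw [map_sum]
      refine Finset.sum_congr rfl fun y _ => ?_
      rw [← smul_eq_mul, ← l.map_smul, ← Pi.single_smul, smul_eq_mul, mul_one]
    -- The separating functional read as an element of `Y`: it yields `‖y₀‖ ≤ c < Re Φ y₀`, against
    -- `‖Φ‖ ≤ 1`.
    set y₀ : Y := ∑ y : E, l (Pi.single y 1) • (y : Y)
    have hy₀ : ∀ f, (y₀ : StrongDual 𝕜 V) f = l (L f) := fun f => by
      rw [hl, Submodule.coe_sum, sum_apply]
      refine Finset.sum_congr rfl fun y _ => ?_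
      simp [L, mul_comm]
    have hΦy₀ : Φ y₀ = l p := by
      rw [hl, map_sum]
      refine Finset.sum_congr rfl fun y _ => ?_
      simp [p, mul_comm]
    have hle : ∀ f : V, ‖f‖ ≤ 1 → ‖(y₀ : StrongDual 𝕜 V) f‖ ≤ c := by
      intro f hf
      obtain ⟨a, ha, hay⟩ := RCLike.exists_norm_eq_mul_self ((y₀ : StrongDual 𝕜 V) f)
      have := hlc (L (a • f)) (subset_closure ⟨a • f, by simpa [norm_smul, ha] using hf, rfl⟩)
      rw [← hy₀, map_smul, smul_eq_mul, ← hay, RCLike.ofReal_re] at this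
      exact this.le
    have hc : 0 ≤ c := (norm_nonneg _).trans (hle 0 (by simp))
    have hnorm : ‖y₀‖ ≤ c := by
      refine ContinuousLinearMap.opNorm_le_of_unit_norm hc fun f hf => hle f ?_
      exact hf.le
    have h1 : ‖Φ y₀‖ ≤ c := (Φ.le_opNorm y₀).trans
      ((mul_le_of_le_one_left (norm_nonneg _) hΦ).trans hnorm)
    rw [← hΦy₀] at hcp
    exact absurd (hcp.trans_le ((RCLike.re_le_norm _).trans h1)) (lt_irrefl _)

/-! ### Weak cluster points and a.e. limits. -/

/-- If a sequence in `L¹(μ)` converges almost everywhere to `g` and every bounded functional along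
it clusters at its value at `h`, then `h = g`. -/
theorem eq_of_tendsto_ae_of_mapClusterPt {α : Type*} [MeasurableSpace α] {𝕜 : Type*} [RCLike 𝕜]
    {μ : Measure α} [TopologicalSpace.SeparableSpace (Lp 𝕜 1 μ)] {v : ℕ → Lp 𝕜 1 μ}
    {g h : Lp 𝕜 1 μ} (hv : ∀ᵐ x ∂μ, Tendsto (fun k => v k x) atTop (𝓝 (g x)))
    (hh : ∀ y : StrongDual 𝕜 (Lp 𝕜 1 μ), MapClusterPt (y h) atTop fun k => y (v k)) :
    h = g := by
  obtain ⟨w, hwm, hw0, hwi, hw⟩ := exists_integrable_weight 𝕜 μ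
  -- On `G n`, of finite measure, the tail `k ≥ n` is dominated by `|g| + 1`, so the integrals
  -- converge without any uniform integrability. Up to a null set the `G n` exhaust `{w > 0}`.
  set G : ℕ → Set α := fun n =>
    {x | ((n : ℝ) + 1)⁻¹ ≤ w x} ∩ ⋂ k ≥ n, {x | ‖v k x - g x‖ ≤ 1}
  have hGm : ∀ n, MeasurableSet (G n) := fun n =>
    (measurableSet_le measurable_const hwm).inter (MeasurableSet.iInter fun k =>
      MeasurableSet.iInter fun _ => measurableSet_le
        ((Lp.stronglyMeasurable (v k)).sub (Lp.stronglyMeasurable g)).norm.measurable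
        measurable_const)
  have hGfin : ∀ n, μ (G n) < ∞ := fun n =>
    (measure_mono Set.inter_subset_left).trans_lt (hwi.measure_ge_lt_top (by positivity))
  have hint : ∀ n, ∀ s, MeasurableSet s → s ⊆ G n → ∫ x in s, h x ∂μ = ∫ x in s, g x ∂μ := by
    intro n s hs hsG
    have hsfin : μ s < ∞ := (measure_mono hsG).trans_lt (hGfin n)
    have : IsFiniteMeasure (μ.restrict s) := ⟨by simpa using hsfin⟩
    set y : StrongDual 𝕜 (Lp 𝕜 1 μ) := (L1.integralCLM' 𝕜).comp (LpToLpRestrictCLM α 𝕜 𝕜 μ 1 s)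
    have hy : ∀ f : Lp 𝕜 1 μ, y f = ∫ x in s, f x ∂μ := fun f => by
      change L1.integralCLM' 𝕜 (LpToLpRestrictCLM α 𝕜 𝕜 μ 1 s f) = _
      rw [← L1.integral_eq', L1.integral_eq_integral]
      exact integral_congr_ae (LpToLpRestrictCLM_coeFn 𝕜 s f)
    have hlim : Tendsto (fun k => y (v k)) atTop (𝓝 (y g)) := by
      simp only [hy]
      refine tendsto_integral_filter_of_dominated_convergence (fun x => ‖g x‖ + 1)
        (Eventually.of_forall fun k => (Lp.stronglyMeasurable (v k)).aestronglyMeasurable) ?_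
        ((L1.integrable_coeFn g).restrict.norm.add (integrable_const _)) (ae_restrict_of_ae hv)
      filter_upwards [eventually_ge_atTop n] with k hk
      filter_upwards [ae_restrict_mem hs] with x hx
      have : ‖v k x - g x‖ ≤ 1 := Set.mem_iInter₂.1 (hsG hx).2 k hk
      linarith [norm_le_norm_add_norm_sub' (v k x) (g x)]
    rw [← hy, ← hy]
    obtain ⟨ψ, hψ, hlim'⟩ := (hh y).tendsto_subseq
    exact tendsto_nhds_unique hlim' (hlim.comp hψ.tendsto_atTop)
  have hG : ∀ n, ∀ᵐ x ∂μ, x ∈ G n → h x = g x := fun n => by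
    refine (ae_restrict_iff' (hGm n)).1 (Integrable.ae_eq_of_forall_setIntegral_eq _ _
      (L1.integrable_coeFn h).restrict (L1.integrable_coeFn g).restrict fun s hs _ => ?_)
    rw [Measure.restrict_restrict hs]
    exact hint n _ (hs.inter (hGm n)) Set.inter_subset_right
  refine Lp.ext ?_
  filter_upwards [ae_all_iff.2 hG, hv, hw h, hw g] with x hx hvx hhx hgx
  rcases (hw0 x).eq_or_lt with h0 | h0
  · rw [hhx h0.symm, hgx h0.symm]
  · have h1 : ∀ᶠ n : ℕ in atTop, ((n : ℝ) + 1)⁻¹ < w x := by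
      have : Tendsto (fun j : ℕ => ((j : ℝ) + 1)⁻¹) atTop (𝓝 0) := by
        simpa using tendsto_one_div_add_atTop_nhds_zero_nat (𝕜 := ℝ)
      exact this.eventually (gt_mem_nhds h0)
    have h2 : ∀ᶠ k in atTop, ‖v k x - g x‖ < 1 :=
      (tendsto_iff_norm_sub_tendsto_zero.1 hvx).eventually (gt_mem_nhds one_pos)
    obtain ⟨N, hN⟩ := eventually_atTop.1 h2
    obtain ⟨n, hn, hnN⟩ := (h1.and (eventually_ge_atTop N)).exists
    exact hx n ⟨hn.le, Set.mem_iInter₂.2 fun k hk => (hN k (hnN.trans hk)).le⟩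

/-- Let `S` be a relatively weakly compact subset of a subspace `X` of `L¹(μ)`. The closure of `S`
for local convergence in measure is contained in its weak closure. -/
theorem exists_mem_weak_closure_of_mem_closure {α : Type*} [MeasurableSpace α] {𝕜 : Type*}
    [RCLike 𝕜] {μ : Measure α} [TopologicalSpace.SeparableSpace (Lp 𝕜 1 μ)]
    {X : Submodule 𝕜 (Lp 𝕜 1 μ)} {S : Set X} {K : Set (WeakSpace 𝕜 X)} (hK : IsCompact K)
    (hSK : ∀ f ∈ S, toWeakSpace 𝕜 X f ∈ K) {g : Lp 𝕜 1 μ}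
    (hg : g ∈ @closure _ (localMeasureTopology 𝕜 μ) (Subtype.val '' S)) :
    ∃ h : X, (h : Lp 𝕜 1 μ) = g ∧ ∀ y : StrongDual 𝕜 X, y h ∈ closure (y '' S) := by
  obtain ⟨u, huS, hu⟩ := exists_seq_tendsto_ae_of_mem_closure hg
  choose v hvS hvu using huS
  obtain ⟨z, -, hz⟩ := hK.exists_mapClusterPt (f := atTop)
    (u := fun k => toWeakSpace 𝕜 X (v k))
    (tendsto_principal.2 (Eventually.of_forall fun k => hSK _ (hvS k)))
  obtain ⟨h, rfl⟩ := (toWeakSpace 𝕜 X).surjective z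
  have hcl : ∀ y : StrongDual 𝕜 X, MapClusterPt (y h) atTop fun k => y (v k) := fun y =>
    hz.continuousAt_comp (f := fun z => y ((toWeakSpace 𝕜 X).symm z))
      (WeakBilin.eval_continuous _ y).continuousAt
  refine ⟨h, eq_of_tendsto_ae_of_mapClusterPt hu fun y => ?_, fun y => ?_⟩
  · have := hcl (y.comp X.subtypeL)
    simpa [hvu] using this
  · exact (hcl y).mem_closure_of_mem _
      (mem_map.2 <| Eventually.of_forall fun k => ⟨v k, hvS k, rfl⟩)

/-! ### Preduals. -/

/-- A space `Y` of functionals on `V` is a predual of `V` if it separates the points of `V` and every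
functional in the unit ball of `Y*` is the evaluation at a point of the unit ball of `V`. -/
theorem exists_linearIsometryEquiv_dual {𝕜 : Type*} [RCLike 𝕜] {V : Type*}
    [NormedAddCommGroup V] [NormedSpace 𝕜 V] (Y : Submodule 𝕜 (StrongDual 𝕜 V))
    (hinj : ∀ f : V, (∀ y ∈ Y, y f = 0) → f = 0)
    (hsurj : ∀ Φ : StrongDual 𝕜 Y, ‖Φ‖ ≤ 1 →
      ∃ f : V, ‖f‖ ≤ 1 ∧ ∀ y : Y, (y : StrongDual 𝕜 V) f = Φ y) :
    ∃ J : V ≃ₗᵢ[𝕜] StrongDual 𝕜 Y, ∀ (f : V) (y : Y), J f y = (y : StrongDual 𝕜 V) f := by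
  let L : V →ₗ[𝕜] StrongDual 𝕜 Y :=
    { toFun := fun f => (ContinuousLinearMap.apply 𝕜 𝕜 f).comp Y.subtypeL
      map_add' := fun f g => by ext y; simp
      map_smul' := fun c f => by ext y; simp }
  have hL : ∀ f (y : Y), L f y = (y : StrongDual 𝕜 V) f := fun f y => rfl
  have hLinj : Function.Injective L := (injective_iff_map_eq_zero L).2 fun f hf =>
    hinj f fun y hy => by rw [← hL f ⟨y, hy⟩, hf]; rfl
  have hLsurj : ∀ Φ : StrongDual 𝕜 Y, ∃ f, ‖f‖ ≤ ‖Φ‖ ∧ L f = Φ := by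
    intro Φ
    rcases eq_or_ne Φ 0 with rfl | hΦ
    · exact ⟨0, by simp, by simp⟩
    have hr : (‖Φ‖ : 𝕜) ≠ 0 := by simpa using hΦ
    have hn : ‖(‖Φ‖ : 𝕜)‖ = ‖Φ‖ := by simp
    obtain ⟨f, hf, hfΦ⟩ := hsurj ((‖Φ‖ : 𝕜)⁻¹ • Φ) (by
      rw [norm_smul, norm_inv, hn, inv_mul_cancel₀ (norm_ne_zero_iff.2 hΦ)])
    refine ⟨(‖Φ‖ : 𝕜) • f, ?_, ?_⟩
    · rw [norm_smul, hn]
      exact mul_le_of_le_one_right (norm_nonneg _) hf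
    · ext y
      rw [hL, map_smul, hfΦ, smul_apply, smul_inv_smul₀ hr]
  refine ⟨⟨LinearEquiv.ofBijective L ⟨hLinj, fun Φ => (hLsurj Φ).imp fun _ h => h.2⟩,
    fun f => ?_⟩, hL⟩
  refine le_antisymm (ContinuousLinearMap.opNorm_le_bound _ (norm_nonneg f) fun y => ?_) ?_
  · rw [mul_comm]
    exact (y : StrongDual 𝕜 V).le_opNorm f
  -- A preimage of `L f` of norm at most `‖L f‖` is `f` itself, by injectivity.
  · obtain ⟨g, hg, hgf⟩ := hLsurj (L f)
    rwa [hLinj hgf] at hg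

/-! ### Consequences of the approximation by weakly compact operators. -/

theorem norm_le_of_tendsto_ae {α : Type*} [MeasurableSpace α] {𝕜 : Type*} [RCLike 𝕜]
    {μ : Measure α} {u : ℕ → Lp 𝕜 1 μ} {f : Lp 𝕜 1 μ} {R : ℝ} (hR : ∀ k, ‖u k‖ ≤ R)
    (h : ∀ᵐ x ∂μ, Tendsto (fun k => u k x) atTop (𝓝 (f x))) : ‖f‖ ≤ R := by
  rw [Lp.norm_def]
  refine ENNReal.toReal_le_of_le_ofReal ((norm_nonneg _).trans (hR 0)) ?_
  exact eLpNorm_le_of_tendsto_ae hR h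

theorem apply_mem_closure_image {α : Type*} [MeasurableSpace α] {𝕜 : Type*} [RCLike 𝕜]
    {μ : Measure α} {T : Lp 𝕜 1 μ → Lp 𝕜 1 μ}
    (hT : ∀ S : Set (Lp 𝕜 1 μ), Bornology.IsBounded S →
      @ContinuousOn (Lp 𝕜 1 μ) (Lp 𝕜 1 μ)
        (localMeasureTopology 𝕜 μ) (localMeasureTopology 𝕜 μ) T S)
    {S : Set (Lp 𝕜 1 μ)} (hS : Bornology.IsBounded S) {f : Lp 𝕜 1 μ}
    (hf : f ∈ @closure _ (localMeasureTopology 𝕜 μ) S) :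
    T f ∈ @closure _ (localMeasureTopology 𝕜 μ) (T '' S) := by
  -- The hypothesis gives continuity within a set only at its own points, so `f` is adjoined to `S`.
  have h := hT (insert f S) (hS.insert f) f (Set.mem_insert f S)
  exact @ContinuousWithinAt.mem_closure_image _ _ (localMeasureTopology 𝕜 μ)
    (localMeasureTopology 𝕜 μ) _ _ _ (@ContinuousWithinAt.mono _ _ (localMeasureTopology 𝕜 μ)
      (localMeasureTopology 𝕜 μ) _ _ _ _ h (Set.subset_insert f S)) hf

/-- Let `T` be an operator on `L¹(μ)` that is continuous on bounded sets for local convergence in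
measure and acts weakly compactly on `X`. Then `T` maps the closure of a subset `S` of the unit ball
of `X`, for local convergence in measure, to the weak closure of `T(S)` in `X`. -/
theorem exists_apply_mem_weak_closure {α : Type*} [MeasurableSpace α] {𝕜 : Type*} [RCLike 𝕜]
    {μ : Measure α} [TopologicalSpace.SeparableSpace (Lp 𝕜 1 μ)]
    {X : Submodule 𝕜 (Lp 𝕜 1 μ)} {T : Lp 𝕜 1 μ →L[𝕜] Lp 𝕜 1 μ} {T' : X →L[𝕜] X}
    (hT' : ∀ f : X, (T' f : Lp 𝕜 1 μ) = T f) (hTwc : IsWeaklyCompactOperator T')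
    (hTm : ∀ S : Set (Lp 𝕜 1 μ), Bornology.IsBounded S →
      @ContinuousOn (Lp 𝕜 1 μ) (Lp 𝕜 1 μ)
        (localMeasureTopology 𝕜 μ) (localMeasureTopology 𝕜 μ) T S)
    {S : Set X} (hS : S ⊆ Metric.closedBall 0 1) {f : Lp 𝕜 1 μ}
    (hf : f ∈ @closure _ (localMeasureTopology 𝕜 μ) (Subtype.val '' S)) :
    ∃ h : X, (h : Lp 𝕜 1 μ) = T f ∧ ∀ y : StrongDual 𝕜 X, y h ∈ closure (y '' (T' '' S)) := by
  refine exists_mem_weak_closure_of_mem_closure hTwc (S := T' '' S) ?_ ?_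
  · rintro _ ⟨g, hg, rfl⟩
    exact subset_closure ⟨g, hS hg, rfl⟩
  · have hbdd : Bornology.IsBounded (Subtype.val '' S : Set (Lp 𝕜 1 μ)) := by
      refine (Metric.isBounded_closedBall (x := (0 : Lp 𝕜 1 μ)) (r := 1)).subset ?_
      rintro _ ⟨g, hg, rfl⟩
      simpa using hS hg
    have := apply_mem_closure_image hTm hbdd hf
    rw [Set.image_image] at this ⊢
    simpa only [hT'] using this

/-- A limit point `f` of the ball has `T n f ∈ X`, and `T n f → f` in norm with `X` norm closed;
Fatou bounds `‖f‖`. -/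
theorem isNicelyPlaced_of_weaklyCompact_approximation {α : Type*} [MeasurableSpace α] {𝕜 : Type*}
    [RCLike 𝕜] {μ : Measure α} [TopologicalSpace.SeparableSpace (Lp 𝕜 1 μ)]
    {X : Submodule 𝕜 (Lp 𝕜 1 μ)} (hX : IsClosed (X : Set (Lp 𝕜 1 μ)))
    {T : ℕ → Lp 𝕜 1 μ →L[𝕜] Lp 𝕜 1 μ}
    (hT : ∀ f : Lp 𝕜 1 μ, Tendsto (fun n => T n f) atTop (𝓝 f)) {T' : ℕ → X →L[𝕜] X}
    (hT' : ∀ n, ∀ f : X, (T' n f : Lp 𝕜 1 μ) = T n f)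
    (hTwc : ∀ n, IsWeaklyCompactOperator (T' n))
    (hTm : ∀ n, ∀ S : Set (Lp 𝕜 1 μ), Bornology.IsBounded S →
      @ContinuousOn (Lp 𝕜 1 μ) (Lp 𝕜 1 μ)
        (localMeasureTopology 𝕜 μ) (localMeasureTopology 𝕜 μ) (T n) S) :
    IsNicelyPlaced X := by
  have himage : {f : Lp 𝕜 1 μ | f ∈ X ∧ ‖f‖ ≤ 1} =
      Subtype.val '' (Metric.closedBall (0 : X) 1) := by
    ext f
    simp [and_comm]
  refine (@closure_subset_iff_isClosed _ (localMeasureTopology 𝕜 μ) _).1 fun f hf => ⟨?_, ?_⟩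
  · refine hX.mem_of_tendsto (hT f) (Eventually.of_forall fun n => ?_)
    rw [himage] at hf
    obtain ⟨h, hh, -⟩ :=
      exists_apply_mem_weak_closure (hT' n) (hTwc n) (hTm n) Set.Subset.rfl hf
    rw [← hh]
    exact h.2
  · obtain ⟨u, hu, huf⟩ := exists_seq_tendsto_ae_of_mem_closure hf
    exact norm_le_of_tendsto_ae (fun k => (hu k).2) huf

/-- These functionals make `X^♯` large enough to separate points. -/
theorem comp_mem_sharpDual {α : Type*} [MeasurableSpace α] {𝕜 : Type*} [RCLike 𝕜]
    {μ : Measure α} [TopologicalSpace.SeparableSpace (Lp 𝕜 1 μ)]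
    {X : Submodule 𝕜 (Lp 𝕜 1 μ)} {T : Lp 𝕜 1 μ →L[𝕜] Lp 𝕜 1 μ} {T' : X →L[𝕜] X}
    (hT' : ∀ f : X, (T' f : Lp 𝕜 1 μ) = T f) (hTwc : IsWeaklyCompactOperator T')
    (hTm : ∀ S : Set (Lp 𝕜 1 μ), Bornology.IsBounded S →
      @ContinuousOn (Lp 𝕜 1 μ) (Lp 𝕜 1 μ)
        (localMeasureTopology 𝕜 μ) (localMeasureTopology 𝕜 μ) T S)
    (y : StrongDual 𝕜 X) : y.comp T' ∈ sharpDual X := by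
  intro f hf V hV
  by_contra hcon
  -- If `f` were a limit point of `S`, then `y (T' f)` would lie in the closure of values avoiding
  -- its neighbourhood `V`.
  set S : Set X := {g | ‖g‖ ≤ 1 ∧ y (T' g) ∉ V}
  have hfS : f ∈ @closure _ (subspaceLocalMeasureTopology X) S := by
    by_contra hfS
    refine hcon ?_
    have hc : (@closure _ (subspaceLocalMeasureTopology X) S)ᶜ ∈
        @nhds _ (subspaceLocalMeasureTopology X) f :=
      @IsOpen.mem_nhds _ (subspaceLocalMeasureTopology X) _ _
        (@isOpen_compl_iff _ _ (subspaceLocalMeasureTopology X) |>.2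
          (@isClosed_closure _ (subspaceLocalMeasureTopology X) S)) hfS
    refine mem_map.2 ((@mem_nhdsWithin_iff_exists_mem_nhds_inter _
      (subspaceLocalMeasureTopology X) _ _ _).2 ⟨_, hc, ?_⟩)
    rintro g ⟨hgS, hg⟩
    by_contra hgV
    exact hgS (@subset_closure _ (subspaceLocalMeasureTopology X) S g ⟨by simpa using hg, hgV⟩)
  have hfS' : (f : Lp 𝕜 1 μ) ∈ @closure _ (localMeasureTopology 𝕜 μ) (Subtype.val '' S) :=
    (@closure_induced _ _ (localMeasureTopology 𝕜 μ) _ _ _).1 hfS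
  obtain ⟨h, hh, hcl⟩ := exists_apply_mem_weak_closure hT' hTwc hTm
    (fun g hg => by simpa using hg.1) hfS'
  obtain rfl : h = T' f := Subtype.ext (hh.trans (hT' f).symm)
  obtain ⟨_, hV', _, ⟨g, hg, rfl⟩, rfl⟩ := mem_closure_iff_nhds.1 (hcl y) V hV
  exact hg.2 hV'

theorem eq_zero_of_norm_natCast_mul_le {𝕜 : Type*} [RCLike 𝕜] {z : 𝕜} {c : ℝ}
    (h : ∀ n : ℕ, ‖(n : 𝕜) * z‖ ≤ c) : z = 0 := by
  by_contra hz
  obtain ⟨n, hn⟩ := Archimedean.arch (c + 1) (norm_pos_iff.2 hz)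
  have := h n
  rw [norm_mul, RCLike.norm_natCast] at this
  rw [nsmul_eq_mul] at hn
  linarith

/-- If `X` is nicely placed, every functional in the unit ball of the dual of `X^♯` is the
evaluation at a point of the unit ball of `X`. -/
theorem IsNicelyPlaced.exists_eval_eq {α : Type*} [MeasurableSpace α] {𝕜 : Type*} [RCLike 𝕜]
    {μ : Measure α} [TopologicalSpace.SeparableSpace (Lp 𝕜 1 μ)]
    {X : Submodule 𝕜 (Lp 𝕜 1 μ)} (hX : IsNicelyPlaced X)
    (Φ : StrongDual 𝕜 (sharpDual X)) (hΦ : ‖Φ‖ ≤ 1) :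
    ∃ f : X, ‖f‖ ≤ 1 ∧ ∀ y : sharpDual X, (y : StrongDual 𝕜 X) f = Φ y := by
  classical
  -- Tolerance `1` loses nothing, since `y` can later be replaced by its multiples.
  set D : Finset (sharpDual X) → Set X := fun E =>
    {f | ‖f‖ ≤ 1 ∧ ∀ y ∈ E, ‖(y : StrongDual 𝕜 X) f - Φ y‖ ≤ 1}
  have hmid : ∀ E, ∀ f ∈ D E, ∀ g ∈ D E, (2⁻¹ : 𝕜) • (f + g) ∈ D E := by
    have h2 : ‖(2⁻¹ : 𝕜)‖ = 2⁻¹ := by rw [norm_inv, RCLike.norm_ofNat]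
    have key : ∀ {a b : 𝕜}, ‖a‖ ≤ 1 → ‖b‖ ≤ 1 → ‖(2⁻¹ : 𝕜) • (a + b)‖ ≤ 1 := by
      intro a b ha hb
      rw [norm_smul, h2]
      linarith [norm_add_le a b]
    rintro E f ⟨hf, hfE⟩ g ⟨hg, hgE⟩
    refine ⟨?_, fun y hy => ?_⟩
    · rw [norm_smul, h2]
      linarith [norm_add_le f g]
    · have e : (y : StrongDual 𝕜 X) ((2⁻¹ : 𝕜) • (f + g)) - Φ y = (2⁻¹ : 𝕜) •
          (((y : StrongDual 𝕜 X) f - Φ y) + ((y : StrongDual 𝕜 X) g - Φ y)) := by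
        rw [map_smul, map_add, smul_eq_mul, smul_eq_mul]
        ring
      rw [e]
      exact key (hfE y hy) (hgE y hy)
  obtain ⟨f, hf⟩ := exists_common_ae_limit (C := fun E => Subtype.val '' D E) (R := 1)
    (fun E E' h => Set.image_mono fun g hg => ⟨hg.1, fun y hy => hg.2 y (Finset.mem_of_subset h hy)⟩)
    (fun E => Set.Nonempty.image _ (exists_closedBall_norm_sub_le _ Φ hΦ E one_pos))
    (by
      rintro E _ ⟨f, hf, rfl⟩ _ ⟨g, hg, rfl⟩
      exact ⟨_, hmid E f hf g hg, rfl⟩)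
    (by
      rintro E _ ⟨f, hf, rfl⟩
      exact hf.1)
  have hfX : f ∈ X ∧ ‖f‖ ≤ 1 := by
    obtain ⟨u, huD, hu⟩ := hf ∅
    refine @IsClosed.mem_of_tendsto _ (localMeasureTopology 𝕜 μ) _ _ _ _ _ _ hX
      (tendsto_localMeasureTopology_of_ae hu) (Eventually.of_forall fun k => ?_)
    obtain ⟨g, hg, hgu⟩ := huD k
    rw [← hgu]
    exact ⟨g.2, hg.1⟩
  have hle : ∀ y : sharpDual X, ‖(y : StrongDual 𝕜 X) ⟨f, hfX.1⟩ - Φ y‖ ≤ 1 := by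
    intro y
    obtain ⟨u, huD, hu⟩ := hf {y}
    choose v hvD hvu using huD
    have hv : Tendsto v atTop (@nhds _ (subspaceLocalMeasureTopology X) ⟨f, hfX.1⟩) := by
      rw [@nhds_induced _ _ (localMeasureTopology 𝕜 μ), tendsto_comap_iff]
      exact (tendsto_localMeasureTopology_of_ae hu).congr fun k => (hvu k).symm
    have hball : (⟨f, hfX.1⟩ : X) ∈ Metric.closedBall (0 : X) 1 := by simpa using hfX.2
    have hlim : Tendsto (fun k => (y : StrongDual 𝕜 X) (v k)) atTop
        (𝓝 ((y : StrongDual 𝕜 X) ⟨f, hfX.1⟩)) :=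
      Tendsto.comp (y.2 _ hball) (@tendsto_nhdsWithin_iff _ _ (subspaceLocalMeasureTopology X) _ _
        _ _ |>.2 ⟨hv, Eventually.of_forall fun k => by simpa using (hvD k).1⟩)
    exact le_of_tendsto (hlim.sub_const (Φ y)).norm
      (Eventually.of_forall fun k => (hvD k).2 y (Finset.mem_singleton_self y))
  refine ⟨⟨f, hfX.1⟩, hfX.2, fun y => ?_⟩
  -- The same `f` serves every `n • y`, so `n * |y f - Φ y| ≤ 1` for all `n`.
  refine sub_eq_zero.1 (eq_zero_of_norm_natCast_mul_le (𝕜 := 𝕜) (c := 1) fun n => ?_)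
  have := hle ((n : 𝕜) • y)
  rwa [Submodule.coe_smul, smul_apply, map_smul, smul_eq_mul, smul_eq_mul, ← mul_sub] at this

theorem proposition8 {α : Type*} [MeasurableSpace α] {𝕜 : Type*} [RCLike 𝕜] (μ : Measure α)
    [TopologicalSpace.SeparableSpace (Lp 𝕜 1 μ)]
    (X : Submodule 𝕜 (Lp 𝕜 1 μ)) (hX : IsClosed (X : Set (Lp 𝕜 1 μ)))
    (T : ℕ → Lp 𝕜 1 μ →L[𝕜] Lp 𝕜 1 μ)
    (hT : ∀ f : Lp 𝕜 1 μ, Tendsto (fun n => ‖T n f - f‖) atTop (𝓝 0))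
    (hTX : ∀ n, ∀ f ∈ X, T n f ∈ X)
    (hTwc : ∀ n, IsWeaklyCompactOperator
      (((T n).comp X.subtypeL).codRestrict X (fun f => hTX n f f.2)))
    (hTm : ∀ n, ∀ S : Set (Lp 𝕜 1 μ), Bornology.IsBounded S →
      @ContinuousOn (Lp 𝕜 1 μ) (Lp 𝕜 1 μ)
        (localMeasureTopology 𝕜 μ) (localMeasureTopology 𝕜 μ) (T n) S) :
    IsNicelyPlaced X ∧
      ∃ J : X ≃ₗᵢ[𝕜] StrongDual 𝕜 (sharpDual X),
        ∀ (f : X) (φ : sharpDual X), J f φ = (φ : StrongDual 𝕜 X) f := by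
  set T' : ℕ → X →L[𝕜] X := fun n =>
    ((T n).comp X.subtypeL).codRestrict X (fun f => hTX n f f.2)
  have hT' : ∀ n, ∀ f : X, (T' n f : Lp 𝕜 1 μ) = T n f := fun _ _ => rfl
  have hlim : ∀ f : Lp 𝕜 1 μ, Tendsto (fun n => T n f) atTop (𝓝 f) := fun f =>
    tendsto_iff_norm_sub_tendsto_zero.2 (hT f)
  have hnice := isNicelyPlaced_of_weaklyCompact_approximation hX hlim hT' hTwc hTm
  refine ⟨hnice, exists_linearIsometryEquiv_dual _ (fun f hf => ?_) hnice.exists_eval_eq⟩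
  -- All `y ∘ T' n` lie in `X^♯` and so kill `f`; as `X*` separates points, `T' n f = 0`, and `f` is
  -- the limit of these.
  have hzero : ∀ n, T' n f = 0 := fun n =>
    (SeparatingDual.eq_zero_iff_forall_dual_eq_zero (R := 𝕜) _).2 fun y =>
      hf _ (comp_mem_sharpDual (hT' n) (hTwc n) (hTm n) y)
  refine Subtype.ext (tendsto_nhds_unique (hlim f) ?_)
  refine tendsto_const_nhds.congr fun n => ?_
  rw [← hT', hzero n]
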